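/- **Theorem 1 (Lusternik–Schnirelmann).** Let $M$ be a closed smooth manifold, that is, a compact Hausdorff smooth manifold without boundary, of some dimension $n\ge 0$ and not necessarily connected. Let $f:M\to\mathbb{R}$ be a function of class $C^2$ and let $\operatorname{Crit} f=\{x\in M : df(x)=0\}$ be its set of critical points. Then $$|\operatorname{Crit} f|\ \ge\ \operatorname{cat}(M).$$ Here $|\operatorname{Crit} f|\in\{0,1,2,\dots\}\cup\{\infty\}$ is the number of critical points. A subset $A\subset M$ is called nullhomotopic if its inclusion into $M$ is homotopic to a constant map, that is, if there are a continuous map $F:[0,1]\times A\to M$ and a point $m\in M$ with $F(0,a)=a$ and $F(1,a)=m$ for all $a\in A$. The Lusternik–Schnirelmann category $\operatorname{cat}(M)$ is the least $\ell\in\{0,1,2,\dots\}$ such that $M$ is covered by $\ell$ open nullhomotopic subsets, and $\operatorname{cat}(M)=\infty$ if there is no such finite cover; in particular $\operatorname{cat}(\emptyset)=0$. -/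

import Mathlib

open scoped Manifold ContDiff

noncomputable section

namespace LusternikSchnirelmann

/-- A subset `A` of `X` is nullhomotopic (contractible in `X`) if the inclusion `A ↪ X` is homotopic,
as a map into `X`, to a constant map. -/
def IsNullhomotopicSubset {X : Type*} [TopologicalSpace X] (A : Set X) : Prop :=
  (⟨Subtype.val, continuous_subtype_val⟩ : C(A, X)).Nullhomotopic

/-- `X` has a cover by `l` open nullhomotopic subsets. -/
def HasCategoricalCover (X : Type*) [TopologicalSpace X] (l : ℕ) : Prop :=
  ∃ U : Fin l → Set X, (∀ i, IsOpen (U i)) ∧ (∀ i, IsNullhomotopicSubset (U i)) ∧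
    ⋃ i, U i = Set.univ

/-- The (unreduced) Lusternik-Schnirelmann category: the least number of sets in a cover of `X` by
open nullhomotopic subsets, and `⊤` if there is no finite such cover. The empty space has
category `0`. -/
def lsCat (X : Type*) [TopologicalSpace X] : ℕ∞ :=
  ⨅ (l : ℕ) (_ : HasCategoricalCover X l), (l : ℕ∞)

/-- The critical points of a real function on an `n`-dimensional manifold: the points where its
differential vanishes. It is meant for differentiable functions. -/
def critSet {n : ℕ} {M : Type*} [TopologicalSpace M] [ChartedSpace (EuclideanSpace ℝ (Fin n)) M]
    (f : M → ℝ) : Set M :=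
  {x | mfderiv (𝓡 n) 𝓘(ℝ, ℝ) f x = 0}

end LusternikSchnirelmann

end

/-!
The proof replaces the gradient flow by finitely many elementary pushes, so it needs no integral
curves and uses only that `f` is of class `C^1`.

A *descent map* is a continuous `g : M → M`, homotopic to the identity, such that every point is
either fixed by `g` or strictly lowered: `g x = x` or `f (g x) < f x`. Descent maps compose. Near a
noncritical point `x` one reads `f` in a chart, picks a direction `v` along which `f` strictly
decreases on a ball, and moves points by a small multiple of `v`, cut off by a bump function; this
is a descent map lowering `f` near `x` (`exists_isDescentMap_lt`). Composing finitely many of these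
lowers `f` strictly on any given compact set without critical points
(`exists_isDescentMap_lt_on`): a point is either moved, hence lowered, by an earlier factor, or it
is still in place when the factor responsible for it acts.

Fix a level `c` and let `U` be the union of contractible chart balls around the critical points at
level `c`. A descent map that strictly lowers the compact set `f⁻¹{c} \ U` carries, by compactness,
`{f ≤ b} \ U` into `{f ≤ a}` for some `a < c < b`. Preimages of nullhomotopic sets under maps
homotopic to the identity are nullhomotopic, so a categorical cover of `{f ≤ a}` gives one of
`{f ≤ b}` with one additional set for each critical point at level `c`
(`exists_coveredBy_of_sublevel`). Looking at the infimum of the levels `c` at which `{f ≤ c}` needs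
more sets than it has critical points then shows that there is no such level
(`coveredBy_sublevel`).
-/

open Set Filter Topology unitInterval

namespace LusternikSchnirelmann

/-! ### Covers by open nullhomotopic sets -/

section Covers

variable {X : Type*} [TopologicalSpace X]

/-- `A` is covered by at most `k` open subsets of `X` that are nullhomotopic in `X`. The cover is a
set of sets and `k` may be `⊤`, so that no enumeration is needed and infinitely many critical points
need no separate treatment. -/
def CoveredBy (A : Set X) (k : ℕ∞) : Prop :=
  ∃ 𝒰 : Set (Set X), 𝒰.encard ≤ k ∧ (∀ U ∈ 𝒰, IsOpen U ∧ IsNullhomotopicSubset U) ∧ A ⊆ ⋃₀ 𝒰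

theorem CoveredBy.mono {A B : Set X} {k l : ℕ∞} (h : CoveredBy A k) (hBA : B ⊆ A) (hkl : k ≤ l) :
    CoveredBy B l := by
  obtain ⟨𝒰, hk, h𝒰, hA⟩ := h
  exact ⟨𝒰, hk.trans hkl, h𝒰, hBA.trans hA⟩

theorem coveredBy_empty (k : ℕ∞) : CoveredBy (∅ : Set X) k :=
  ⟨∅, by simp, by simp, by simp⟩

theorem CoveredBy.union {A B : Set X} {k l : ℕ∞} (hA : CoveredBy A k) (hB : CoveredBy B l) :
    CoveredBy (A ∪ B) (k + l) := by
  obtain ⟨𝒰, hk, h𝒰, hA⟩ := hA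
  obtain ⟨𝒱, hl, h𝒱, hB⟩ := hB
  refine ⟨𝒰 ∪ 𝒱, (encard_union_le _ _).trans (add_le_add hk hl), ?_, ?_⟩
  · rintro U (hU | hU)
    exacts [h𝒰 U hU, h𝒱 U hU]
  · rw [sUnion_union]
    exact union_subset_union hA hB

/-- First deform `g ⁻¹' U` into `U` by the homotopy from the identity to `g`, then contract `U`. -/
theorem IsNullhomotopicSubset.preimage {U : Set X} (hU : IsNullhomotopicSubset U) {g : C(X, X)}
    (hg : ContinuousMap.Homotopic (ContinuousMap.id X) g) : IsNullhomotopicSubset (g ⁻¹' U) := by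
  obtain ⟨m, hm⟩ := hU
  let ι : C(g ⁻¹' U, X) := ⟨Subtype.val, continuous_subtype_val⟩
  let r : C(g ⁻¹' U, U) := ⟨fun x ↦ ⟨g x, x.2⟩, by fun_prop⟩
  refine ⟨m, ?_⟩
  have h₁ : ContinuousMap.Homotopic ((ContinuousMap.id X).comp ι) (g.comp ι) :=
    hg.comp (ContinuousMap.Homotopic.refl ι)
  have h₂ := hm.comp (ContinuousMap.Homotopic.refl r)
  exact h₁.trans h₂

theorem CoveredBy.preimage {A : Set X} {k : ℕ∞} (hA : CoveredBy A k) {g : C(X, X)}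
    (hg : ContinuousMap.Homotopic (ContinuousMap.id X) g) : CoveredBy (g ⁻¹' A) k := by
  obtain ⟨𝒰, hk, h𝒰, hA⟩ := hA
  refine ⟨(g ⁻¹' ·) '' 𝒰, (encard_image_le _ _).trans hk, ?_, ?_⟩
  · rintro _ ⟨U, hU, rfl⟩
    exact ⟨(h𝒰 U hU).1.preimage g.continuous, (h𝒰 U hU).2.preimage hg⟩
  · intro x hx
    obtain ⟨U, hU, hxU⟩ := hA hx
    exact ⟨_, mem_image_of_mem _ hU, hxU⟩

theorem lsCat_le_of_coveredBy {k : ℕ∞} (h : CoveredBy (univ : Set X) k) : lsCat X ≤ k := by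
  obtain ⟨𝒰, hk, h𝒰, hX⟩ := h
  refine le_trans ?_ hk
  rcases 𝒰.finite_or_infinite with hfin | hinf
  · have : Finite 𝒰 := hfin
    rw [hfin.encard_eq_coe]
    let e : Fin 𝒰.ncard ≃ 𝒰 := (Finite.equivFin 𝒰).symm
    refine iInf₂_le _ ⟨fun i ↦ e i, fun i ↦ (h𝒰 _ (e i).2).1, fun i ↦ (h𝒰 _ (e i).2).2, ?_⟩
    refine eq_univ_of_forall fun x ↦ ?_
    obtain ⟨U, hU, hxU⟩ := hX (mem_univ x)
    exact mem_iUnion.2 ⟨e.symm ⟨U, hU⟩, by simpa using hxU⟩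
  · simp [hinf.encard_eq]

/-- Every point of a manifold has an open nullhomotopic neighbourhood, namely a ball in a chart. -/
theorem exists_isOpen_isNullhomotopicSubset {E : Type*} [NormedAddCommGroup E] [NormedSpace ℝ E]
    [ChartedSpace E X] (x : X) : ∃ U : Set X, IsOpen U ∧ x ∈ U ∧ IsNullhomotopicSubset U := by
  set e := chartAt E x
  obtain ⟨r, hr, hball⟩ := Metric.isOpen_iff.1 e.open_target _ (mem_chart_target E x)
  set B := Metric.ball (e x) r
  refine ⟨e.source ∩ e ⁻¹' B, e.isOpen_inter_preimage Metric.isOpen_ball,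
    ⟨mem_chart_source E x, Metric.mem_ball_self hr⟩, ?_⟩
  have : ContractibleSpace B :=
    (convex_ball (e x) r).contractibleSpace ⟨e x, Metric.mem_ball_self hr⟩
  let p : C((e.source ∩ e ⁻¹' B : Set X), B) :=
    ⟨fun y ↦ ⟨e y, y.2.2⟩, Continuous.subtype_mk
      (e.continuousOn.comp_continuous continuous_subtype_val fun y ↦ y.2.1) _⟩
  let q : C(B, X) :=
    ⟨fun y ↦ e.symm y, e.continuousOn_symm.comp_continuous continuous_subtype_val
      fun y ↦ hball y.2⟩
  have h := ((id_nullhomotopic B).comp_right q).comp_left p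
  have hpq : (q.comp (ContinuousMap.id B)).comp p = ⟨Subtype.val, continuous_subtype_val⟩ := by
    ext y
    exact e.left_inv y.2.1
  rwa [hpq] at h

end Covers

/-! ### Descent maps -/

section Descent

variable {X : Type*} [TopologicalSpace X] {f : X → ℝ}

/-- A descent map of `f`: a continuous self-map homotopic to the identity that strictly lowers `f`
at every point it moves. Nothing is asked of the values of `f` along the homotopy. -/
structure IsDescentMap (f : X → ℝ) (g : C(X, X)) : Prop where
  homotopic_id : ContinuousMap.Homotopic (ContinuousMap.id X) g
  eq_or_lt : ∀ x, g x = x ∨ f (g x) < f x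

theorem IsDescentMap.le {g : C(X, X)} (hg : IsDescentMap f g) (x : X) : f (g x) ≤ f x := by
  rcases hg.eq_or_lt x with h | h
  exacts [by rw [h], h.le]

theorem isDescentMap_id : IsDescentMap f (ContinuousMap.id X) :=
  ⟨.refl _, fun _ ↦ .inl rfl⟩

theorem IsDescentMap.comp {g h : C(X, X)} (hg : IsDescentMap f g) (hh : IsDescentMap f h) :
    IsDescentMap f (g.comp h) := by
  refine ⟨hg.homotopic_id.comp hh.homotopic_id, fun x ↦ ?_⟩
  rcases hh.eq_or_lt x with h' | h'
  · simpa [h'] using hg.eq_or_lt x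
  · exact .inr ((hg.le _).trans_lt h')

/-- If each point of a compact set is strictly lowered by some descent map, then a finite composite
of such maps strictly lowers all of them at once. -/
theorem exists_isDescentMap_lt_on_compact (hf : Continuous f) {K : Set X} (hK : IsCompact K)
    (hloc : ∀ x ∈ K, ∃ g, IsDescentMap f g ∧ f (g x) < f x) :
    ∃ g, IsDescentMap f g ∧ ∀ x ∈ K, f (g x) < f x := by
  refine hK.induction_on (p := fun s ↦ ∃ g, IsDescentMap f g ∧ ∀ x ∈ s, f (g x) < f x)
    ⟨_, isDescentMap_id, by simp⟩ ?_ ?_ ?_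
  · rintro s t hst ⟨g, hg, hlt⟩
    exact ⟨g, hg, fun x hx ↦ hlt x (hst hx)⟩
  · rintro s t ⟨g, hg, hgs⟩ ⟨h, hh, hht⟩
    refine ⟨h.comp g, hh.comp hg, ?_⟩
    rintro x (hx | hx)
    · exact (hh.le _).trans_lt (hgs x hx)
    · -- Either `g` fixes `x`, and `h` strictly lowers it, or `g` has strictly lowered `x` already.
      rcases hg.eq_or_lt x with h' | h'
      · simpa [h'] using hht x hx
      · exact (hh.le _).trans_lt h'
  · intro x hx
    obtain ⟨g, hg, hlt⟩ := hloc x hx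
    exact ⟨{y | f (g y) < f y}, mem_nhdsWithin_of_mem_nhds
      ((isOpen_lt (hf.comp g.continuous) hf).mem_nhds hlt), g, hg, fun _ hy ↦ hy⟩

/-- A homotopy `h` of the model space that starts at the identity and is supported in a compact subset
`C` of the chart target transplants to `X`, where it is extended by the identity outside the chart.
Hausdorffness makes the image of `C` closed in `X`, which gives continuity of the extension. -/
theorem exists_homotopic_id_of_chart [T2Space X] {E : Type*} [TopologicalSpace E]
    (e : OpenPartialHomeomorph X E) {C : Set E} (hC : IsCompact C) (hCe : C ⊆ e.target)
    {h : I × E → E} (hcont : Continuous h) (hmaps : ∀ t, ∀ y ∈ C, h (t, y) ∈ e.target)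
    (hfix : ∀ t, ∀ y ∉ C, h (t, y) = y) (hzero : ∀ y, h (0, y) = y) :
    ∃ g : C(X, X), ContinuousMap.Homotopic (ContinuousMap.id X) g ∧
      (∀ x ∈ e.source, g x = e.symm (h (1, e x))) ∧ ∀ x ∉ e.source, g x = x := by
  classical
  let H : I × X → X := fun p ↦ if p.2 ∈ e.source then e.symm (h (p.1, e p.2)) else p.2
  have hmaps' : ∀ t, ∀ y ∈ e.target, h (t, y) ∈ e.target := fun t y hy ↦ by
    by_cases hyC : y ∈ C
    · exact hmaps t y hyC
    · rwa [hfix t y hyC]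
  have hK : IsClosed (e.symm '' C) :=
    (hC.image_of_continuousOn (e.continuousOn_symm.mono hCe)).isClosed
  have hHK : ∀ p : I × X, p.2 ∉ e.symm '' C → H p = p.2 := fun p hp ↦ by
    by_cases hps : p.2 ∈ e.source
    · have : e p.2 ∉ C := fun hpC ↦ hp ⟨_, hpC, e.left_inv hps⟩
      simp [H, hps, hfix _ _ this]
    · simp [H, hps]
  have hH : Continuous H := by
    refine continuous_iff_continuousAt.2 fun p ↦ ?_
    by_cases hp : p.2 ∈ e.source
    · have hopen : IsOpen (Prod.snd ⁻¹' e.source : Set (I × X)) :=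
        e.open_source.preimage continuous_snd
      have hon : ContinuousOn (fun q : I × X ↦ e.symm (h (q.1, e q.2)))
          (Prod.snd ⁻¹' e.source) := by
        refine e.continuousOn_symm.comp (hcont.comp_continuousOn
          (continuousOn_fst.prodMk (e.continuousOn.comp continuousOn_snd fun q hq ↦ hq))) ?_
        exact fun q hq ↦ hmaps' _ _ (e.map_source hq)
      refine (hon.continuousAt (hopen.mem_nhds hp)).congr ?_
      filter_upwards [hopen.mem_nhds hp] with q hq
      exact (if_pos hq).symm
    · have hpK : p.2 ∉ e.symm '' C := by
        rintro ⟨y, hy, hyp⟩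
        exact hp (hyp ▸ e.map_target (hCe hy))
      refine continuousAt_snd.congr ?_
      filter_upwards [(hK.isOpen_compl.preimage continuous_snd).mem_nhds hpK] with q hq
      exact (hHK q hq).symm
  refine ⟨⟨fun x ↦ H (1, x), by fun_prop⟩, ⟨⟨⟨H, hH⟩, fun x ↦ ?_, fun x ↦ rfl⟩⟩,
    fun x hx ↦ if_pos hx, fun x hx ↦ if_neg hx⟩
  by_cases hx : x ∈ e.source
  · simp [H, hx, hzero]
  · simp [H, hx]

end Descent

/-! ### Pushing down in a vector space -/

/-- Near a noncritical point there is a direction `v` along which `F` strictly decreases, with one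
and the same `v` on a whole ball. The bounds on `v` keep the segments `y - a • v` in the ball of
radius `2 * r`, hence in `T`. -/
theorem exists_lt_of_fderiv_ne_zero {E : Type*} [NormedAddCommGroup E] [NormedSpace ℝ E]
    {F : E → ℝ} {T : Set E} (hT : IsOpen T) (hF : ContDiffOn ℝ 1 F T) {y₀ : E} (hy₀ : y₀ ∈ T)
    (hne : fderiv ℝ F y₀ ≠ 0) :
    ∃ (r : ℝ) (v : E), 0 < r ∧ ‖v‖ ≤ r ∧ Metric.ball y₀ (2 * r) ⊆ T ∧
      ∀ y ∈ Metric.ball y₀ r, ∀ a : ℝ, 0 < a → a ≤ 1 → F (y - a • v) < F y := by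
  obtain ⟨w, hw⟩ : ∃ w, 0 < fderiv ℝ F y₀ w := by
    obtain ⟨w, hw⟩ := DFunLike.ne_iff.1 hne
    rcases lt_or_gt_of_ne hw with h | h
    · exact ⟨-w, by simpa using h⟩
    · exact ⟨w, by simpa using h⟩
  have hcont : ContinuousAt (fun y ↦ fderiv ℝ F y w) y₀ :=
    ((hF.continuousOn_fderiv_of_isOpen hT le_rfl).continuousAt (hT.mem_nhds hy₀)).clm_apply
      continuousAt_const
  obtain ⟨ρ, hρ, hball⟩ := Metric.mem_nhds_iff.1
    (inter_mem (hT.mem_nhds hy₀) (hcont.eventually (lt_mem_nhds hw)))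
  have hw1 : 0 < ‖w‖ + 1 := by positivity
  have hs : 0 < ρ / 2 / (‖w‖ + 1) := by positivity
  have hr : 0 < ρ / 2 := half_pos hρ
  have h2 : 2 * (ρ / 2) = ρ := by ring
  have hv : ‖(ρ / 2 / (‖w‖ + 1)) • w‖ ≤ ρ / 2 := by
    rw [norm_smul, Real.norm_of_nonneg hs.le, div_mul_eq_mul_div, div_le_iff₀ hw1]
    gcongr
    linarith
  refine ⟨ρ / 2, (ρ / 2 / (‖w‖ + 1)) • w, hr, hv,
    by rw [h2]; exact hball.trans inter_subset_left, fun y hy a ha0 ha1 ↦ ?_⟩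
  set v := (ρ / 2 / (‖w‖ + 1)) • w with hvdef
  have hmem : ∀ b ∈ Icc (0 : ℝ) 1, y - b • v ∈ Metric.ball y₀ ρ := by
    intro b hb
    rw [Metric.mem_ball, dist_eq_norm] at hy ⊢
    have hbv : ‖b • v‖ ≤ ρ / 2 := by
      rw [norm_smul, Real.norm_of_nonneg hb.1]
      exact (mul_le_of_le_one_left (norm_nonneg _) hb.2).trans hv
    calc ‖y - b • v - y₀‖ = ‖(y - y₀) - b • v‖ := by congr 1; abel
      _ ≤ ‖y - y₀‖ + ‖b • v‖ := norm_sub_le _ _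
      _ < ρ := by linarith
  have hderiv : ∀ b ∈ Icc (0 : ℝ) 1,
      HasDerivAt (fun b : ℝ ↦ F (y - b • v)) (fderiv ℝ F (y - b • v) (-v)) b := by
    intro b hb
    have hd : DifferentiableAt ℝ F (y - b • v) :=
      (hF.differentiableOn one_ne_zero).differentiableAt (hT.mem_nhds (hball (hmem b hb)).1)
    have hl : HasDerivAt (fun b : ℝ ↦ y - b • v) (-v) b := by
      simpa using ((hasDerivAt_id b).smul_const v).const_sub y
    exact hd.hasFDerivAt.comp_hasDerivAt b hl
  have hanti : StrictAntiOn (fun b : ℝ ↦ F (y - b • v)) (Icc 0 1) := by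
    refine strictAntiOn_of_deriv_neg (convex_Icc 0 1)
      (fun b hb ↦ (hderiv b hb).continuousAt.continuousWithinAt) fun b hb ↦ ?_
    have hb' := interior_subset hb
    rw [(hderiv b hb').deriv, hvdef, ← smul_neg, map_smul, map_neg, smul_eq_mul]
    have : 0 < fderiv ℝ F (y - b • v) w := (hball (hmem b hb')).2
    nlinarith
  simpa using hanti (left_mem_Icc.2 zero_le_one) ⟨ha0.le, ha1⟩ ha0

/-! ### Sublevel sets on a manifold -/

section Manifold

variable {n : ℕ} {M : Type*} [TopologicalSpace M] [ChartedSpace (EuclideanSpace ℝ (Fin n)) M]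
  {f : M → ℝ}

/-- A noncritical point of `f` is noncritical for the expression of `f` in the chart. -/
theorem fderiv_chart_ne_zero [IsManifold (𝓡 n) 1 M] (hf : ContMDiff (𝓡 n) 𝓘(ℝ, ℝ) 1 f) {x : M}
    (hx : x ∉ critSet (n := n) f) :
    fderiv ℝ (f ∘ (chartAt (EuclideanSpace ℝ (Fin n)) x).symm)
      (chartAt (EuclideanSpace ℝ (Fin n)) x x) ≠ 0 := by
  set e := chartAt (EuclideanSpace ℝ (Fin n)) x
  intro h0
  refine hx ?_
  have he : MDifferentiableAt (𝓡 n) (𝓡 n) e x :=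
    mdifferentiableAt_atlas (chart_mem_atlas _ x) (mem_chart_source _ x)
  have hes : MDifferentiableAt (𝓡 n) (𝓡 n) e.symm (e x) :=
    mdifferentiableAt_atlas_symm (chart_mem_atlas _ x) (mem_chart_target _ x)
  have hF : MDifferentiableAt (𝓡 n) 𝓘(ℝ, ℝ) (f ∘ e.symm) (e x) :=
    (hf.mdifferentiable one_ne_zero _).comp _ hes
  have heq : f =ᶠ[𝓝 x] (f ∘ e.symm) ∘ e := by
    filter_upwards [e.open_source.mem_nhds (mem_chart_source _ x)] with y hy
    simp [e.left_inv hy]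
  change mfderiv (𝓡 n) 𝓘(ℝ, ℝ) f x = 0
  rw [heq.mfderiv_eq, mfderiv_comp x hF he, mfderiv_eq_fderiv, h0]
  exact ContinuousLinearMap.zero_comp _

/-- The local push: each noncritical point is strictly lowered by a descent map. -/
theorem exists_isDescentMap_lt [T2Space M] [IsManifold (𝓡 n) 1 M]
    (hf : ContMDiff (𝓡 n) 𝓘(ℝ, ℝ) 1 f) {x : M} (hx : x ∉ critSet (n := n) f) :
    ∃ g, IsDescentMap f g ∧ f (g x) < f x := by
  have hne := fderiv_chart_ne_zero hf hx
  set e := chartAt (EuclideanSpace ℝ (Fin n)) x with he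
  have hF : ContDiffOn ℝ 1 (f ∘ e.symm) e.target :=
    contMDiffOn_iff_contDiffOn.1 (hf.comp_contMDiffOn contMDiffOn_chart_symm)
  obtain ⟨r, v, hr, hv, hball, hlt⟩ :=
    exists_lt_of_fderiv_ne_zero e.open_target hF (mem_chart_target _ x) hne
  -- A tent function: positive exactly on the ball of radius `r`, with value `1` at the centre.
  let ψ : EuclideanSpace ℝ (Fin n) → ℝ := fun y ↦ max 0 (1 - dist y (e x) / r)
  have hψ0 : ∀ y, 0 ≤ ψ y := fun y ↦ le_max_left _ _
  have hψ1 : ∀ y, ψ y ≤ 1 := fun y ↦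
    max_le zero_le_one (sub_le_self _ (by positivity))
  have hψpos : ∀ y, 0 < ψ y → y ∈ Metric.ball (e x) r := fun y hy ↦ by
    simpa [ψ, div_lt_one hr] using hy
  obtain ⟨g, hg, hgs, hgn⟩ := exists_homotopic_id_of_chart e
    (C := Metric.closedBall (e x) r) (isCompact_closedBall _ _)
    ((Metric.closedBall_subset_ball (by linarith)).trans hball)
    (h := fun p ↦ p.2 - ((p.1 : ℝ) * ψ p.2) • v) (by fun_prop)
    (fun t y hy ↦ by
      by_cases h0 : ψ y = 0
      · simpa [h0] using hball (Metric.closedBall_subset_ball (by linarith) hy)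
      · have hy' := hψpos y ((hψ0 y).lt_of_ne' h0)
        refine hball ?_
        rw [Metric.mem_ball, dist_eq_norm] at hy' ⊢
        have ht : (t : ℝ) * ψ y ≤ 1 := mul_le_one₀ t.2.2 (hψ0 y) (hψ1 y)
        have htv : ‖((t : ℝ) * ψ y) • v‖ ≤ r := by
          rw [norm_smul, Real.norm_of_nonneg (mul_nonneg t.2.1 (hψ0 y))]
          exact (mul_le_of_le_one_left (norm_nonneg _) ht).trans hv
        calc ‖y - ((t : ℝ) * ψ y) • v - e x‖ = ‖(y - e x) - ((t : ℝ) * ψ y) • v‖ := by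
              congr 1; abel
          _ ≤ ‖y - e x‖ + ‖((t : ℝ) * ψ y) • v‖ := norm_sub_le _ _
          _ < 2 * r := by linarith)
    (fun t y hy ↦ by
      have h0 : ψ y = 0 := ((hψ0 y).eq_of_not_lt fun h ↦
        hy (Metric.ball_subset_closedBall (hψpos y h))).symm
      simp [h0])
    (fun y ↦ by simp)
  have key : ∀ y ∈ e.source, 0 < ψ (e y) → f (g y) < f y := fun y hy hpos ↦ by
    have := hlt (e y) (hψpos _ hpos) (ψ (e y)) hpos (hψ1 _)
    simpa [hgs y hy, e.left_inv hy] using this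
  refine ⟨g, ⟨hg, fun y ↦ ?_⟩, key x (mem_chart_source _ x) (by simp [ψ])⟩
  by_cases hy : y ∈ e.source
  · rcases (hψ0 (e y)).eq_or_lt with h0 | hpos
    · exact .inl (by simp [hgs y hy, ← h0, e.left_inv hy])
    · exact .inr (key y hy hpos)
  · exact .inl (hgn y hy)

theorem exists_isDescentMap_lt_on [T2Space M] [IsManifold (𝓡 n) 1 M]
    (hf : ContMDiff (𝓡 n) 𝓘(ℝ, ℝ) 1 f) {K : Set M} (hK : IsCompact K)
    (hcrit : Disjoint K (critSet (n := n) f)) :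
    ∃ g, IsDescentMap f g ∧ ∀ x ∈ K, f (g x) < f x :=
  exists_isDescentMap_lt_on_compact hf.continuous hK fun _ hx ↦
    exists_isDescentMap_lt hf (disjoint_left.1 hcrit hx)

/-- Passing a level `c` costs at most one nullhomotopic set for each critical point at this level.
This includes regular levels, where nothing is added. -/
theorem exists_coveredBy_of_sublevel [T2Space M] [CompactSpace M] [IsManifold (𝓡 n) 1 M]
    (hf : ContMDiff (𝓡 n) 𝓘(ℝ, ℝ) 1 f) (c : ℝ) :
    ∃ a b : ℝ, a < c ∧ c < b ∧ ∀ k : ℕ∞, CoveredBy {x | f x ≤ a} k →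
      CoveredBy {x | f x ≤ b} (k + (critSet (n := n) f ∩ f ⁻¹' {c}).encard) := by
  choose V hVo hxV hV using
    exists_isOpen_isNullhomotopicSubset (X := M) (E := EuclideanSpace ℝ (Fin n))
  set S := critSet (n := n) f ∩ f ⁻¹' {c}
  set U := ⋃₀ (V '' S) with hUdef
  have hU : IsOpen U := isOpen_sUnion (by rintro _ ⟨x, -, rfl⟩; exact hVo x)
  have hSU : S ⊆ U := fun x hx ↦ ⟨_, mem_image_of_mem V hx, hxV x⟩
  have hUcov : CoveredBy U S.encard :=
    ⟨V '' S, encard_image_le _ _, by rintro _ ⟨x, -, rfl⟩; exact ⟨hVo x, hV x⟩, subset_rfl⟩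
  have hfc := hf.continuous
  obtain ⟨g, hg, hlt⟩ := exists_isDescentMap_lt_on hf (K := f ⁻¹' {c} \ U)
    ((isClosed_singleton.preimage hfc).sdiff hU).isCompact
    (disjoint_left.2 fun x hx hxc ↦ hx.2 (hSU ⟨hxc, hx.1⟩))
  -- The open set `W ∪ U` contains `{f ≤ c}`, hence also `{f ≤ b'}` for some `b' > c`.
  set W := {x | f (g x) < c}
  have hfg : Continuous (f ∘ g) := hfc.comp g.continuous
  have hW : IsOpen W := isOpen_lt hfg continuous_const
  obtain ⟨b, hcb, hb⟩ := ((hW.union hU).isClosed_compl.isCompact).exists_forall_le'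
    hfc.continuousOn (a := c) fun x hx ↦ by
      by_contra! hle
      rcases hle.lt_or_eq with h | h
      · exact hx (.inl ((hg.le x).trans_lt h))
      · by_cases hxU : x ∈ U
        · exact hx (.inr hxU)
        · exact hx (.inl ((hlt x ⟨h, hxU⟩).trans_eq h))
  -- Any level strictly between `c` and `b` lies below all values of `f` outside `W ∪ U`.
  obtain ⟨b', hcb', hb'⟩ := exists_between hcb
  have hLW : {x | f x ≤ b'} \ U ⊆ W := fun x hx ↦ by
    by_contra hxW
    exact absurd (hb x fun h ↦ h.elim hxW hx.2) (not_le.2 (hx.1.trans_lt hb'))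
  -- On the compact set `{f ≤ b'} \ U ⊆ W` the values of `f ∘ g` stay away from `c`.
  obtain ⟨a, hca, ha⟩ :=
    ((isClosed_le hfc continuous_const).sdiff hU).isCompact.exists_forall_le'
      (s := {x | f x ≤ b'} \ U) hfg.neg.continuousOn (a := -c) fun x hx ↦ neg_lt_neg (hLW hx)
  refine ⟨-a, b', by linarith, hcb', fun k hk ↦ ?_⟩
  refine ((hk.preimage hg.homotopic_id).union hUcov).mono (fun x hx ↦ ?_) le_rfl
  by_cases hxU : x ∈ U
  exacts [.inr hxU, .inl (le_neg_of_le_neg (ha x ⟨hx, hxU⟩))]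

/-- Lusternik–Schnirelmann for sublevel sets. -/
theorem coveredBy_sublevel [T2Space M] [CompactSpace M] [IsManifold (𝓡 n) 1 M]
    (hf : ContMDiff (𝓡 n) 𝓘(ℝ, ℝ) 1 f) (c : ℝ) :
    CoveredBy {x | f x ≤ c} (critSet (n := n) f ∩ {x | f x ≤ c}).encard := by
  by_contra hc
  -- The levels at which the claim fails.
  set B := {c : ℝ | ¬ CoveredBy {x | f x ≤ c} (critSet (n := n) f ∩ {x | f x ≤ c}).encard}
  obtain ⟨m, hm⟩ : ∃ m, ∀ x, m ≤ f x := by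
    obtain ⟨m, hm⟩ := (isCompact_range hf.continuous).bddBelow
    exact ⟨m, fun x ↦ hm (mem_range_self x)⟩
  have hB : BddBelow B := ⟨m, fun d hd ↦ by
    by_contra! hdm
    refine hd ?_
    have : {x | f x ≤ d} = ∅ := eq_empty_of_forall_notMem fun x hx ↦
      absurd ((hm x).trans hx) (not_le.2 hdm)
    rw [this]
    exact coveredBy_empty _⟩
  -- No level below `sInf B` is in `B`, and passing `sInf B` clears all levels up to some `b` above.
  obtain ⟨a, b, ha, hb, hab⟩ := exists_coveredBy_of_sublevel hf (sInf B)
  obtain ⟨d, hdB, hdb⟩ := exists_lt_of_csInf_lt ⟨c, hc⟩ hb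
  have hd : sInf B ≤ d := csInf_le hB hdB
  have hcov := hab _ (not_not.1 (notMem_of_lt_csInf ha hB))
  refine hdB (hcov.mono (fun x hx ↦ le_trans hx hdb.le) ?_)
  rw [← encard_union_eq]
  · refine encard_le_encard (union_subset ?_ ?_) <;> rintro x ⟨hx, hxc⟩
    · exact ⟨hx, le_trans hxc (ha.le.trans hd)⟩
    · exact ⟨hx, (mem_singleton_iff.1 hxc).trans_le hd⟩
  · refine disjoint_left.2 fun x hx hx' ↦ ?_
    exact absurd hx.2 (not_le.2 (ha.trans_eq (mem_singleton_iff.1 hx'.2).symm))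

end Manifold

end LusternikSchnirelmann

theorem theorem1 {n : ℕ} {M : Type*} [TopologicalSpace M] [T2Space M] [CompactSpace M]
    [ChartedSpace (EuclideanSpace ℝ (Fin n)) M] [IsManifold (𝓡 n) ∞ M]
    (f : M → ℝ) (hf : ContMDiff (𝓡 n) 𝓘(ℝ, ℝ) 2 f) :
    LusternikSchnirelmann.lsCat M ≤
      (LusternikSchnirelmann.critSet (n := n) f).encard := by
  have : IsManifold (𝓡 n) 1 M := .of_le (n := ∞) (by simp)
  obtain ⟨c, hc⟩ := (isCompact_range hf.continuous).bddAbove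
  have hall : {x | f x ≤ c} = Set.univ := Set.eq_univ_of_forall fun x ↦ hc (Set.mem_range_self x)
  have h := LusternikSchnirelmann.coveredBy_sublevel (hf.of_le one_le_two) c
  rw [hall, Set.inter_univ] at h
  exact LusternikSchnirelmann.lsCat_le_of_coveredBy h
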